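/- Throughout, arithmetic is over $\mathrm{GF}(2)$ and $\log=\log_2$. A XOR-circuit is a finite directed acyclic graph whose fan-in-zero vertices are its $n$ input gates and whose other vertices (of unbounded fan-in) output the sum modulo 2 of their in-neighbours; its size is its number of wires, and its outputs are designated non-input gates. For an $m\times n$ matrix $A$ over $\mathrm{GF}(2)$ let $C_{\oplus}(A)$ be the minimum size of a XOR-circuit computing $x\mapsto Ax$. A random $n\times n$ matrix $\mathbf A$ over $\mathrm{GF}(2)$ is called $k$-uniform if each of its $k\times k$ submatrices is uniformly distributed on $\{0,1\}^{k\times k}$. **Theorem.** There are $n^{\Omega(1)}$-uniform random $n\times n$ matrices $\mathbf A$ with $C_{\oplus}(\mathbf A)=O(n)$ for every outcome of $\mathbf A$. More precisely, put $k(n)=\lfloor\sqrt n/\log n\rfloor$ for $n\ge 2$; there is $\varepsilon>0$ with $k(n)\ge n^{\varepsilon}$ for all sufficiently large $n$. There is a constant $C$ such that for every $n\ge2$ there are $m\le C\sqrt n$ and an $m\times n$ matrix $P$ over $\mathrm{GF}(2)$ with $C_{\oplus}(P)\le Cn$, every $k(n)$ columns of which are linearly independent, such that, for $\mathbf R$ uniformly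 random in $\mathrm{GF}(2)^{m\times m}$, the random matrix $\mathbf A=P^{\top}\mathbf R P$ is $k(n)$-uniform, and $C_{\oplus}(P^{\top}RP)\le Cn$ for every $R\in\mathrm{GF}(2)^{m\times m}$. -/

import Mathlib

/-- A XOR-circuit with `n` inputs and `m` outputs: a finite directed acyclic graph on the vertex set
`Fin n ⊕ Gate`. The vertices `Sum.inl j` are the input gates (they have fan-in zero, as no wire ends
in them); the elements of `Gate` are the arithmetic gates, which have unbounded positive fan-in and
unbounded fan-out. A pair `(u, g)` in `wires` is a wire from the vertex `u` to the gate `g`. Each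
output is an arithmetic gate. -/
structure XorCircuit (n m : ℕ) where
  Gate : Type
  [fintypeGate : Fintype Gate]
  wires : Finset ((Fin n ⊕ Gate) × Gate)
  fanIn_pos : ∀ g : Gate, ∃ u : Fin n ⊕ Gate, (u, g) ∈ wires
  acyclic : ∀ g : Gate, ¬ Relation.TransGen (fun h h' : Gate => (Sum.inr h, h') ∈ wires) g g
  output : Fin m → Gate

namespace XorCircuit

/-- The size of a circuit is its number of wires. -/
def size {n m : ℕ} (c : XorCircuit n m) : ℕ := c.wires.card

open Classical in
/-- `c.IsEval x v` says that `v` is the assignment of values to the arithmetic gates on input `x`: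
the value of each gate is the sum modulo 2 of the values of the sources of its incoming wires. -/
def IsEval {n m : ℕ} (c : XorCircuit n m) (x : Fin n → ZMod 2) (v : c.Gate → ZMod 2) : Prop :=
  ∀ g : c.Gate, v g = ∑ w ∈ c.wires with w.2 = g, Sum.elim x v w.1

/-- Since the circuit is acyclic, every input determines exactly one assignment of gate values. -/
theorem existsUnique_isEval {n m : ℕ} (c : XorCircuit n m) (x : Fin n → ZMod 2) :
    ∃! v : c.Gate → ZMod 2, c.IsEval x v := by
  classical
  have := c.fintypeGate
  let r : c.Gate → c.Gate → Prop :=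
    Relation.TransGen (fun h h' : c.Gate => (Sum.inr h, h') ∈ c.wires)
  have : Std.Irrefl r := ⟨c.acyclic⟩
  have : IsTrans c.Gate r := ⟨fun _ _ _ => Relation.TransGen.trans⟩
  have wf : WellFounded r := Finite.wellFounded_of_trans_of_irrefl r
  let F : (g : c.Gate) → ((h : c.Gate) → r h g → ZMod 2) → ZMod 2 := fun g ih =>
    ∑ w ∈ c.wires with w.2 = g,
      Sum.elim x (fun h => if hr : r h g then ih h hr else 0) w.1
  have key : ∀ (v : c.Gate → ZMod 2) (g : c.Gate),
      F g (fun h _ => v h) = ∑ w ∈ c.wires with w.2 = g, Sum.elim x v w.1 := by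
    intro v g
    refine Finset.sum_congr rfl ?_
    rintro ⟨u, g'⟩ hw
    have hmem : (u, g') ∈ c.wires := (Finset.mem_filter.1 hw).1
    obtain rfl : g' = g := (Finset.mem_filter.1 hw).2
    cases u with
    | inl j => rfl
    | inr h =>
      have hr : r h g' := Relation.TransGen.single hmem
      simp [hr]
  refine ⟨wf.fix F, fun g => ?_, fun v hv => ?_⟩
  · rw [← key, wf.fix_eq]
  · funext g
    induction g using wf.induction with
    | _ g ih =>
      rw [hv g, ← key, wf.fix_eq]
      refine congrArg (F g) ?_
      funext h hr
      exact ih h hr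

/-- The circuit `c` computes the linear map `x ↦ A x` over GF(2). -/
def Computes {n m : ℕ} (c : XorCircuit n m) (A : Matrix (Fin m) (Fin n) (ZMod 2)) : Prop :=
  ∀ x : Fin n → ZMod 2, ∃ v : c.Gate → ZMod 2,
    c.IsEval x v ∧ ∀ i : Fin m, v (c.output i) = A.mulVec x i

end XorCircuit

/-- The XOR-complexity of a matrix: the minimum number of wires in a XOR-circuit computing
`x ↦ A x` (with value `⊤` if there were no such circuit). -/
noncomputable def xorComplexity {n m : ℕ} (A : Matrix (Fin m) (Fin n) (ZMod 2)) : ℕ∞ :=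
  ⨅ (c : XorCircuit n m) (_ : c.Computes A), (c.size : ℕ∞)

/-- A random `n × n` matrix over GF(2), given by its distribution `p`, is `k`-uniform if the
restriction to each `k × k` submatrix is uniformly distributed. -/
def IsKUniform {n : ℕ} (k : ℕ) (p : PMF (Matrix (Fin n) (Fin n) (ZMod 2))) : Prop :=
  ∀ I J : Finset (Fin n), I.card = k → J.card = k →
    p.map (fun A => A.submatrix (fun i : I => (i : Fin n)) (fun j : J => (j : Fin n))) =
      PMF.uniformOfFintype (Matrix I J (ZMod 2))

/-- The integer part of `√n / log₂ n`. -/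
noncomputable def uniformityParam (n : ℕ) : ℕ := ⌊√(n : ℝ) / Real.logb 2 (n : ℝ)⌋₊

/-! A submatrix of `Pᵀ R P` is `P_Iᵀ R P_J`, where `P_I` and `P_J` consist of `k` columns of `P`. If
these are independent, the map from `R` to the submatrix is linear and onto, so it carries the
uniform distribution to the uniform one (`isKUniform_transpose_mul_mul`). As `R` has `m² = O(n)`
entries, what remains is a cheap `P` with `O(√n)` rows and no nonzero kernel vector of weight at
most `k`.

A random `P` with columns of logarithmic weight would cost `n log n` wires. Instead `P = Q * A`
(`exists_sparse_factors`): `A` has columns of weight at most 8 and only about `n / log n` rows, and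
`Q` has columns of weight `O(log n)`, so each has `O(n)` ones. Since `A` sends nonzero vectors of
weight at most `k` to nonzero vectors of weight at most `8k`, it is enough that `Q` kills none of
those.

Both factors come from `exists_sparse_matrix`: make each column a sum of `2c` random unit vectors. A
kernel vector with support `S` forces every row to be hit an even number of times, so `2c|S|` balls
occupy at most `c|S|` bins. This is unlikely enough for a union bound over `S`. -/

open Classical in
/-- The value `a` if `p` holds and `0` otherwise, where `p` is decided classically. -/
noncomputable def valueIf {R : Type*} [Zero R] (p : Prop) (a : R) : R := if p then a else 0

theorem valueIf_eq_ite {R : Type*} [Zero R] (p : Prop) [Decidable p] (a : R) :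
    valueIf p a = if p then a else 0 := by
  unfold valueIf
  congr

/-! ### Constructing circuits: single matrices and products -/

namespace XorCircuit

open Classical in
theorem isEval_iff {n m : ℕ} (c : XorCircuit n m) [Fintype c.Gate] (x : Fin n → ZMod 2)
    (v : c.Gate → ZMod 2) :
    c.IsEval x v ↔ ∀ g, v g = ∑ u, valueIf ((u, g) ∈ c.wires) (Sum.elim x v u) := by
  refine forall_congr' fun g => ?_
  suffices h : (∑ w ∈ c.wires with w.2 = g, Sum.elim x v w.1) =
      ∑ u, valueIf ((u, g) ∈ c.wires) (Sum.elim x v u) by rw [h]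
  simp only [valueIf_eq_ite]
  rw [← Finset.sum_filter]
  refine Finset.sum_bij' (fun w _ => w.1) (fun u _ => (u, g)) ?_ ?_ ?_ ?_ ?_
  · rintro ⟨u, g'⟩ hw
    obtain ⟨hw, rfl⟩ := Finset.mem_filter.1 hw
    simpa using hw
  · intro u hu
    simpa using hu
  · rintro ⟨u, g'⟩ hw
    obtain ⟨hw, rfl⟩ := Finset.mem_filter.1 hw
    rfl
  · intro u _
    rfl
  · intro w _
    rfl

open Classical in
theorem size_eq_sum {n m : ℕ} (c : XorCircuit n m) [Fintype c.Gate] :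
    c.size = ∑ g : c.Gate, ∑ u : Fin n ⊕ c.Gate, valueIf ((u, g) ∈ c.wires) 1 := by
  simp only [valueIf_eq_ite]
  rw [size, ← Fintype.sum_prod_type_right (fun p => if p ∈ c.wires then 1 else 0)]
  simp

theorem wellFounded_wires {n m : ℕ} (c : XorCircuit n m) :
    WellFounded (fun h h' : c.Gate => (Sum.inr h, h') ∈ c.wires) := by
  have := c.fintypeGate
  let r : c.Gate → c.Gate → Prop :=
    Relation.TransGen (fun h h' : c.Gate => (Sum.inr h, h') ∈ c.wires)
  have : Std.Irrefl r := ⟨c.acyclic⟩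
  have : IsTrans c.Gate r := ⟨fun _ _ _ => Relation.TransGen.trans⟩
  have wf : WellFounded r := Finite.wellFounded_of_trans_of_irrefl r
  exact Subrelation.wf (fun h => Relation.TransGen.single h) wf

open Classical in
/-- The circuit with a given well-founded wire relation. -/
noncomputable def ofRel {n m : ℕ} (G : Type) [Fintype G] (W : Fin n ⊕ G → G → Prop)
    (hpos : ∀ g, ∃ u, W u g) (hwf : WellFounded (fun h h' => W (Sum.inr h) h'))
    (out : Fin m → G) : XorCircuit n m where
  Gate := G
  wires := Finset.univ.filter (fun p => W p.1 p.2)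
  fanIn_pos g := by simpa using hpos g
  acyclic g hg := by
    have : WellFounded (Relation.TransGen (fun h h' => W (Sum.inr h) h')) := hwf.transGen
    exact this.irrefl.irrefl g (by simpa using hg)
  output := out

section ofRel

variable {n m : ℕ} {G : Type} [Fintype G] {W : Fin n ⊕ G → G → Prop}
    {hpos : ∀ g, ∃ u, W u g} {hwf : WellFounded (fun h h' => W (Sum.inr h) h')}
    {out : Fin m → G}

theorem size_ofRel : (ofRel G W hpos hwf out).size = ∑ g, ∑ u, valueIf (W u g) 1 := by
  classical
  rw [@size_eq_sum n m _ ‹Fintype G›]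
  refine Finset.sum_congr rfl fun g _ => Finset.sum_congr rfl fun u _ => ?_
  congr 1
  exact propext <| Finset.mem_filter.trans <|
    and_iff_right (Finset.mem_univ (α := (Fin n ⊕ G) × G) (u, g))

theorem isEval_ofRel {x : Fin n → ZMod 2} {v : G → ZMod 2} :
    (ofRel G W hpos hwf out).IsEval x v ↔
      ∀ g, v g = ∑ u, valueIf (W u g) (Sum.elim x v u) := by
  classical
  refine (@isEval_iff n m (ofRel G W hpos hwf out) ‹Fintype G› x v).trans ?_
  refine forall_congr' fun g => Eq.congr rfl (Finset.sum_congr rfl fun u _ => ?_)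
  congr 1
  exact propext <| Finset.mem_filter.trans <|
    and_iff_right (Finset.mem_univ (α := (Fin n ⊕ G) × G) (u, g))

end ofRel

/-- The wires of the circuit of depth two evaluating the rows of `A`. Two copies of the input `j₀`
are fed into every row, so that rows without entries also have positive fan-in. -/
def rowWire {n m : ℕ} (A : Matrix (Fin m) (Fin n) (ZMod 2)) (j₀ : Fin n) :
    Fin n ⊕ (Fin m ⊕ Fin 2) → Fin m ⊕ Fin 2 → Prop
  | .inl j, .inl i => A i j ≠ 0
  | .inl j, .inr _ => j = j₀
  | .inr (.inr _), .inl _ => True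
  | .inr (.inl _), .inl _ => False
  | .inr (.inl _), .inr _ => False
  | .inr (.inr _), .inr _ => False

/-- The wires of the composition of two circuits, with a buffer gate for each output of the first
circuit. -/
def compWire {n l m : ℕ} (a : XorCircuit l m) (b : XorCircuit n l) :
    Fin n ⊕ (b.Gate ⊕ (Fin l ⊕ a.Gate)) → b.Gate ⊕ (Fin l ⊕ a.Gate) → Prop
  | .inl j, .inl g => (.inl j, g) ∈ b.wires
  | .inr (.inl h), .inl g => (.inr h, g) ∈ b.wires
  | .inr (.inr _), .inl _ => False
  | .inl _, .inr (.inl _) => False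
  | .inr (.inl h), .inr (.inl i) => b.output i = h
  | .inr (.inr _), .inr (.inl _) => False
  | .inl _, .inr (.inr _) => False
  | .inr (.inl _), .inr (.inr _) => False
  | .inr (.inr (.inl i)), .inr (.inr g) => (.inl i, g) ∈ a.wires
  | .inr (.inr (.inr h)), .inr (.inr g) => (.inr h, g) ∈ a.wires

/-- The extra `2 * m + 2` wires belong to the two copies of one input; in characteristic 2 they
cancel in every row. -/
theorem exists_computes {n m : ℕ} (hn : 0 < n) (A : Matrix (Fin m) (Fin n) (ZMod 2)) :
    ∃ c : XorCircuit n m, c.Computes A ∧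
      c.size = (∑ i, ∑ j, if A i j ≠ 0 then 1 else 0) + 2 * m + 2 := by
  classical
  let j₀ : Fin n := ⟨0, hn⟩
  have hpos : ∀ g, ∃ u, rowWire A j₀ u g := by
    rintro (i | t)
    · exact ⟨.inr (.inr 0), trivial⟩
    · exact ⟨.inl j₀, rfl⟩
  have hwf : WellFounded (fun h h' => rowWire A j₀ (Sum.inr h) h') := by
    refine Subrelation.wf (r := InvImage (· < ·) (Sum.elim (fun _ => 1) fun _ => 0 :
      Fin m ⊕ Fin 2 → ℕ)) ?_ (InvImage.wf _ wellFounded_lt)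
    rintro (i | t) (i' | t') h <;> simp_all [rowWire, InvImage]
  refine ⟨ofRel (Fin m ⊕ Fin 2) (rowWire A j₀) hpos hwf Sum.inl,
    fun x => ⟨Sum.elim (A.mulVec x) fun _ => x j₀, ?_, fun i => rfl⟩, ?_⟩
  · rw [isEval_ofRel]
    rintro (i | t)
    · have h2 : x j₀ + x j₀ = 0 := CharTwo.add_self_eq_zero _
      have h1 : ∀ a y : ZMod 2, (if a = 0 then 0 else y) = a * y := by decide
      simp only [Fintype.sum_sum_type, rowWire]
      simp only [valueIf_eq_ite]
      simp [h1, Matrix.mulVec, dotProduct, Fin.sum_univ_two, -Finset.sum_const, h2]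
    · simp only [Fintype.sum_sum_type, rowWire]
      simp only [valueIf_eq_ite]
      simp
  · rw [size_ofRel]
    simp only [Fintype.sum_sum_type, rowWire]
    simp only [valueIf_eq_ite]
    simp [Finset.sum_add_distrib]
    ring

/-- The `l` buffer wires keep the inputs of `a` distinct: wires form a set, so if two outputs of `b`
were the same gate, identifying inputs of `a` with it could merge two wires into one. -/
theorem exists_computes_mul {n l m : ℕ} {A : Matrix (Fin m) (Fin l) (ZMod 2)}
    {B : Matrix (Fin l) (Fin n) (ZMod 2)} {a : XorCircuit l m} {b : XorCircuit n l}
    (ha : a.Computes A) (hb : b.Computes B) :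
    ∃ c : XorCircuit n m, c.Computes (A * B) ∧ c.size = a.size + b.size + l := by
  classical
  let _ := a.fintypeGate
  let _ := b.fintypeGate
  have hpos : ∀ g, ∃ u, compWire a b u g := by
    rintro (g | i | g)
    · obtain ⟨u | u, hu⟩ := b.fanIn_pos g
      · exact ⟨.inl u, hu⟩
      · exact ⟨.inr (.inl u), hu⟩
    · exact ⟨.inr (.inl (b.output i)), rfl⟩
    · obtain ⟨u | u, hu⟩ := a.fanIn_pos g
      · exact ⟨.inr (.inr (.inl u)), hu⟩
      · exact ⟨.inr (.inr (.inr u)), hu⟩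
  have hwf : WellFounded (fun h h' => compWire a b (Sum.inr h) h') := by
    -- Wires between different layers only go from `b` to the buffers to `a`, and no wire joins two
    -- buffers.
    refine Subrelation.wf ?_ (Sum.lex_wf b.wellFounded_wires
      (Sum.lex_wf (emptyWf (α := Fin l)).wf a.wellFounded_wires))
    rintro (g | i | g) (g' | i' | g') h <;> simp_all [compWire]
  refine ⟨ofRel (b.Gate ⊕ (Fin l ⊕ a.Gate)) (compWire a b) hpos hwf
    (fun i => .inr (.inr (a.output i))), fun x => ?_, ?_⟩
  · obtain ⟨v, hv, hvB⟩ := hb x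
    obtain ⟨w, hw, hwA⟩ := ha (B.mulVec x)
    refine ⟨Sum.elim v (Sum.elim (B.mulVec x) w), ?_, fun i => ?_⟩
    · rw [isEval_ofRel]
      rw [isEval_iff] at hv hw
      simp only [Fintype.sum_sum_type, valueIf_eq_ite] at hv hw
      rintro (g | i | g)
      · simp only [Fintype.sum_sum_type, compWire]
        simp only [valueIf_eq_ite]
        simpa using hv g
      · simp only [Fintype.sum_sum_type, compWire]
        simp only [valueIf_eq_ite]
        simp [hvB]
      · simp only [Fintype.sum_sum_type, compWire]
        simp only [valueIf_eq_ite]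
        simpa using hw g
    · rw [← Matrix.mulVec_mulVec, ← hwA i]
      rfl
  · rw [size_ofRel, size_eq_sum, size_eq_sum]
    simp only [Fintype.sum_sum_type, compWire]
    simp only [valueIf_eq_ite]
    simp
    ring

end XorCircuit

/-! ### Bounds on XOR-complexity -/

theorem xorComplexity_le_iff {n m : ℕ} {A : Matrix (Fin m) (Fin n) (ZMod 2)} {s : ℕ} :
    xorComplexity A ≤ s ↔ ∃ c : XorCircuit n m, c.Computes A ∧ c.size ≤ s := by
  constructor
  · intro h
    have h' : xorComplexity A < ((s + 1 : ℕ) : ℕ∞) :=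
      lt_of_le_of_lt h (by exact_mod_cast Nat.lt_succ_self s)
    simp only [xorComplexity, iInf_lt_iff] at h'
    obtain ⟨c, hc, hs⟩ := h'
    exact ⟨c, hc, Nat.lt_succ_iff.1 (by exact_mod_cast hs)⟩
  · rintro ⟨c, hc, hs⟩
    exact (iInf₂_le c hc).trans (by exact_mod_cast hs)

theorem xorComplexity_le {n m : ℕ} (hn : 0 < n) (A : Matrix (Fin m) (Fin n) (ZMod 2)) {s : ℕ}
    (hs : (∑ i, ∑ j, if A i j ≠ 0 then 1 else 0) ≤ s) :
    xorComplexity A ≤ (s + 2 * m + 2 : ℕ) := by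
  obtain ⟨c, hc, hcs⟩ := XorCircuit.exists_computes hn A
  exact xorComplexity_le_iff.2 ⟨c, hc, by omega⟩

theorem xorComplexity_mul_le {n l m : ℕ} {A : Matrix (Fin m) (Fin l) (ZMod 2)}
    {B : Matrix (Fin l) (Fin n) (ZMod 2)} {s t : ℕ} (ha : xorComplexity A ≤ s)
    (hb : xorComplexity B ≤ t) : xorComplexity (A * B) ≤ (s + t + l : ℕ) := by
  obtain ⟨a, ha, has⟩ := xorComplexity_le_iff.1 ha
  obtain ⟨b, hb, hbs⟩ := xorComplexity_le_iff.1 hb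
  obtain ⟨c, hc, hcs⟩ := XorCircuit.exists_computes_mul ha hb
  exact xorComplexity_le_iff.2 ⟨c, hc, by omega⟩

/-! ### Uniformity from independent columns -/

/-- All fibres are cosets of the kernel, so the image distribution is constant; total mass 1 fixes
the constant. -/
theorem PMF.map_uniformOfFintype_of_surjective {G H : Type*} [AddGroup G] [AddGroup H] [Fintype G]
    [Fintype H] (f : G →+ H) (hf : Function.Surjective f) :
    (PMF.uniformOfFintype G).map f = PMF.uniformOfFintype H := by
  classical
  have key : ∀ x, ((PMF.uniformOfFintype G).map f) x = ((PMF.uniformOfFintype G).map f) 0 := by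
    intro x
    have h := AddMonoidHom.card_fiber_eq_of_mem_range f (hf x) (hf 0)
    simp only [PMF.map_apply, PMF.uniformOfFintype_apply, tsum_fintype, ← Finset.sum_filter,
      Finset.sum_const]
    simp_rw [eq_comm (a := x), eq_comm (a := (0 : H)), h]
  have hsum := ((PMF.uniformOfFintype G).map f).tsum_coe
  ext x
  simp_rw [tsum_fintype, key, Finset.sum_const, Finset.card_univ, nsmul_eq_mul] at hsum
  rw [PMF.uniformOfFintype_apply, key]
  exact ENNReal.eq_inv_of_mul_eq_one_left (by rwa [mul_comm])

theorem Matrix.exists_left_inverse {m ι K : Type*} [Fintype m] [Fintype ι] [DecidableEq ι]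
    [DecidableEq m] [Field K] (A : Matrix m ι K) (hA : LinearIndependent K A.col) :
    ∃ L : Matrix ι m K, L * A = 1 := by
  have hinj : Function.Injective A.mulVec := Matrix.mulVec_injective_iff.2 hA
  obtain ⟨g, hg⟩ := LinearMap.exists_leftInverse_of_injective (Matrix.toLin' A)
    (LinearMap.ker_eq_bot.2 hinj)
  refine ⟨LinearMap.toMatrix' g, ?_⟩
  rw [← LinearMap.toMatrix'_toLin' A, ← LinearMap.toMatrix'_comp, hg, LinearMap.toMatrix'_id]

theorem isKUniform_transpose_mul_mul {m n k : ℕ} (P : Matrix (Fin m) (Fin n) (ZMod 2))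
    (hP : ∀ J : Finset (Fin n), J.card = k →
      LinearIndependent (ZMod 2) (fun j : J => P.col (j : Fin n))) :
    IsKUniform k ((PMF.uniformOfFintype (Matrix (Fin m) (Fin m) (ZMod 2))).map
      (fun R => P.transpose * R * P)) := by
  intro I J hI hJ
  obtain ⟨L, hL⟩ := Matrix.exists_left_inverse (P.submatrix id (fun i : I => (i : Fin n)))
    (hP I hI)
  obtain ⟨M, hM⟩ := Matrix.exists_left_inverse (P.submatrix id (fun i : J => (i : Fin n)))
    (hP J hJ)
  rw [PMF.map_comp]
  let f : Matrix (Fin m) (Fin m) (ZMod 2) →+ Matrix I J (ZMod 2) :=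
    { toFun := fun R => (P.transpose * R * P).submatrix (fun i : I => (i : Fin n))
        (fun j : J => (j : Fin n))
      map_zero' := by simp
      map_add' := fun R S => by
        rw [Matrix.mul_add, Matrix.add_mul, Matrix.submatrix_add]
        rfl }
  -- With `L` and `M` left inverses of the selected columns, `Lᵀ S M` is a preimage of `S`.
  refine PMF.map_uniformOfFintype_of_surjective f fun S => ⟨L.transpose * S * M, ?_⟩
  have e : f (L.transpose * S * M) = (L * P.submatrix id (fun i : I => (i : Fin n))).transpose * S *
      (M * P.submatrix id (fun i : J => (i : Fin n))) := by
    change (P.transpose * (L.transpose * S * M) * P).submatrix _ _ = _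
    rw [Matrix.submatrix_mul _ _ _ id _ Function.bijective_id,
      Matrix.submatrix_mul _ _ _ id _ Function.bijective_id, Matrix.transpose_mul]
    simp only [Matrix.mul_assoc, Matrix.submatrix_id_id, Matrix.transpose_submatrix]
  rw [e, hL, hM]
  simp

/-! ### Counting functions with small image -/

open Finset in
/-- A function all of whose fibres over `s` have even size takes at most `#s / 2` values on `s`. -/
theorem Finset.two_mul_card_image_le_of_even {α β : Type*} [DecidableEq β] (s : Finset α)
    (f : α → β) (h : ∀ b, Even #{a ∈ s | f a = b}) : 2 * #(s.image f) ≤ #s := by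
  refine mul_card_image_le_card s 2 fun b hb => ?_
  obtain ⟨a, ha, rfl⟩ := mem_image.1 hb
  have : 0 < #{a' ∈ s | f a' = f a} := card_pos.2 ⟨a, by simp [ha]⟩
  obtain ⟨r, hr⟩ := h (f a)
  omega

open Finset in
/-- The number of functions mapping the set `s` onto at most `r` values. -/
theorem card_filter_card_image_le {α β : Type*} [Fintype α] [DecidableEq α] [Fintype β]
    [DecidableEq β] (s : Finset α) (r : ℕ) (hr : r ≤ Fintype.card β) :
    #{f : α → β | #(s.image f) ≤ r} ≤
      (Fintype.card β).choose r * (r ^ #s * Fintype.card β ^ (Fintype.card α - #s)) := by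
  calc #{f : α → β | #(s.image f) ≤ r}
      ≤ #((powersetCard r univ).biUnion fun T : Finset β =>
          Fintype.piFinset fun a => if a ∈ s then T else univ) := by
        -- Enlarge the image to a set `T` of exactly `r` values; this is where `hr` enters.
        refine card_le_card fun f hf => ?_
        obtain ⟨T, hT, -, hTr⟩ := exists_subsuperset_card_eq (subset_univ (s.image f))
          (by simpa using hf) (by simpa using hr)
        simp only [mem_biUnion, mem_powersetCard, Fintype.mem_piFinset]
        refine ⟨T, ⟨subset_univ T, hTr⟩, fun a => ?_⟩
        split_ifs with ha
        · exact hT (mem_image_of_mem f ha)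
        · exact mem_univ _
    _ ≤ #(powersetCard r (univ : Finset β)) * (r ^ #s * Fintype.card β ^ (Fintype.card α - #s)) := by
        refine card_biUnion_le_card_mul _ _ _ fun T hT => ?_
        rw [Fintype.card_piFinset]
        simp only [apply_ite card, (mem_powersetCard.1 hT).2, card_univ]
        rw [prod_ite, prod_const, prod_const]
        simp [filter_not, ← compl_eq_univ_sdiff, card_compl]
    _ = _ := by simp

/-- The quotient is one term of the series for `e ^ r`. -/
theorem pow_self_div_factorial_le (r : ℕ) : (r : ℝ) ^ r / r.factorial ≤ 3 ^ r := by
  refine (Real.pow_div_factorial_le_exp r r.cast_nonneg r).trans ?_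
  rw [← mul_one (r : ℝ), Real.exp_nat_mul]
  exact pow_le_pow_left₀ (Real.exp_pos _).le Real.exp_one_lt_three.le r

/-- Divided by `M ^ L`, this bounds the probability that `2r` marked balls among `L` occupy at most
`r` of `M` bins. -/
theorem choose_mul_pow_le (M r L : ℕ) (hM : 0 < M) (hL : 2 * r ≤ L) :
    ((M.choose r * (r ^ (2 * r) * M ^ (L - 2 * r)) : ℕ) : ℝ) ≤ (3 * r / M) ^ r * M ^ L := by
  have hM' : (0 : ℝ) < M := by exact_mod_cast hM
  push_cast
  calc (M.choose r : ℝ) * (r ^ (2 * r) * M ^ (L - 2 * r))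
      ≤ M ^ r / r.factorial * (r ^ (2 * r) * M ^ (L - 2 * r)) := by
        gcongr
        exact Nat.choose_le_pow_div r M
    _ = (r : ℝ) ^ r / r.factorial * (M ^ r * r ^ r * M ^ (L - 2 * r)) := by ring
    _ ≤ 3 ^ r * (M ^ r * r ^ r * M ^ (L - 2 * r)) := by
        gcongr
        exact pow_self_div_factorial_le r
    _ = (3 * r / M) ^ r * M ^ L := by
        obtain ⟨t, rfl⟩ := Nat.exists_eq_add_of_le hL
        rw [Nat.add_sub_cancel_left, div_pow, mul_pow, pow_add, pow_mul]
        field_simp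
        ring

-- By the binomial theorem the sum is `(1 + q) ^ N - 1 ≤ e ^ (1/4) - 1`, and `e < 16`.
open Finset in
theorem sum_powerset_erase_empty_pow_lt_one {N : ℕ} {q : ℝ} (hq : 0 ≤ q) (h : N * q ≤ 1 / 4) :
    ∑ S ∈ (univ : Finset (Fin N)).powerset.erase ∅, q ^ #S < 1 := by
  have h1 := sum_pow_mul_eq_add_pow q 1 (univ : Finset (Fin N))
  rw [← add_sum_erase _ _ (empty_mem_powerset _)] at h1
  simp only [one_pow, mul_one, card_empty, pow_zero, card_univ, Fintype.card_fin] at h1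
  have h2 : (q + 1) ^ N ≤ Real.exp (1 / 4) := by
    calc (q + 1) ^ N ≤ Real.exp q ^ N :=
          pow_le_pow_left₀ (by positivity) (Real.add_one_le_exp q) N
      _ = Real.exp (N * q) := (Real.exp_nat_mul q N).symm
      _ ≤ _ := Real.exp_le_exp.2 h
  have h3 : Real.exp (1 / 4) < 2 := by
    have : Real.exp (1 / 4) ^ 4 < 2 ^ 4 := by
      rw [← Real.exp_nat_mul]
      norm_num
      linarith [Real.exp_one_lt_three]
    exact lt_of_pow_lt_pow_left₀ 4 (by norm_num) this
  linarith

/-! ### Random sparse matrices without light kernel vectors -/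

/-- The matrix over GF(2) whose column `j` is the sum of the unit vectors indexed by `f (j, t)`. -/
def hashMatrix {N M d : ℕ} (f : Fin N × Fin d → Fin M) : Matrix (Fin M) (Fin N) (ZMod 2) :=
  fun i j => ((Finset.univ.filter fun t => f (j, t) = i).card : ZMod 2)

open Finset in
theorem card_hashMatrix_col_le {N M d : ℕ} (f : Fin N × Fin d → Fin M) (j : Fin N) :
    #{i | hashMatrix f i j ≠ 0} ≤ d := by
  calc #{i | hashMatrix f i j ≠ 0} ≤ #(univ.image fun t => f (j, t)) := by
        refine card_le_card fun i hi => ?_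
        by_contra hc
        have : #{t | f (j, t) = i} = 0 := by
          rw [card_eq_zero, filter_eq_empty_iff]
          intro t _ ht
          exact hc (mem_image.2 ⟨t, mem_univ t, ht⟩)
        exact (mem_filter.1 hi).2 (by rw [hashMatrix, this, Nat.cast_zero])
    _ ≤ d := card_image_le.trans (by simp)

open Finset in
theorem hashMatrix_mulVec {N M d : ℕ} (f : Fin N × Fin d → Fin M) (x : Fin N → ZMod 2)
    (i : Fin M) : (hashMatrix f).mulVec x i =
      (#{p ∈ ({j | x j ≠ 0} : Finset (Fin N)) ×ˢ (univ : Finset (Fin d)) | f p = i} : ZMod 2) := by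
  have h1 : ∀ a y : ZMod 2, a * y = if y ≠ 0 then a else 0 := by decide
  simp only [Matrix.mulVec, dotProduct, h1, hashMatrix, ← sum_filter]
  rw [card_filter, sum_product, Nat.cast_sum]
  exact sum_congr rfl fun j _ => by rw [card_filter]

open Finset in
/-- By a union bound over the possible supports, there is a matrix with at most `2 * c` ones in
every column whose kernel has no nonzero vector of weight at most `K`. -/
theorem exists_sparse_matrix {N M c K : ℕ} (hN : 0 < N) (hM : 0 < M) (hc : 0 < c)
    (h : (N : ℝ) * (3 * c * K / M) ^ c ≤ 1 / 4) :
    ∃ A : Matrix (Fin M) (Fin N) (ZMod 2), (∀ j, #{i | A i j ≠ 0} ≤ 2 * c) ∧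
      ∀ x : Fin N → ZMod 2, x ≠ 0 → hammingNorm x ≤ K → A.mulVec x ≠ 0 := by
  have hN' : (1 : ℝ) ≤ N := by exact_mod_cast hN
  have hM' : (0 : ℝ) < M := by exact_mod_cast hM
  set q : ℝ := (3 * c * K / M) ^ c with hq
  have hq0 : 0 ≤ q := by positivity
  -- Otherwise `q ≥ 1`, contradicting `N * q ≤ 1 / 4`. The count of `bad S` needs at least `c * #S`
  -- bins.
  have hcK : c * K ≤ M := by
    have h1 : (3 * c * K / M : ℝ) ≤ 1 := by
      by_contra! hc1
      have := one_le_pow₀ (n := c) hc1.le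
      nlinarith
    rw [div_le_one hM'] at h1
    have : (c * K : ℝ) ≤ M := by nlinarith [(by positivity : (0 : ℝ) ≤ c * K)]
    exact_mod_cast this
  let bad : Finset (Fin N) → Finset (Fin N × Fin (2 * c) → Fin M) := fun S =>
    {f | #((S ×ˢ (univ : Finset (Fin (2 * c)))).image f) ≤ c * #S}
  let 𝒮 : Finset (Finset (Fin N)) := {S ∈ univ.powerset.erase ∅ | #S ≤ K}
  have hbad : ∀ S ∈ 𝒮, (#(bad S) : ℝ) ≤ q ^ #S * M ^ (N * (2 * c)) := by
    intro S hS
    have hSK : #S ≤ K := (mem_filter.1 hS).2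
    have e : #(S ×ˢ (univ : Finset (Fin (2 * c)))) = 2 * (c * #S) := by
      rw [card_product, card_univ, Fintype.card_fin]
      ring
    have h1 := card_filter_card_image_le (β := Fin M) (S ×ˢ (univ : Finset (Fin (2 * c))))
      (c * #S) (by rw [Fintype.card_fin]; exact (Nat.mul_le_mul_left c hSK).trans hcK)
    rw [e] at h1
    simp only [Fintype.card_fin, Fintype.card_prod] at h1
    have hSN : #S ≤ N := by simpa using card_le_univ S
    have h2 := choose_mul_pow_le M (c * #S) (N * (2 * c)) hM (by nlinarith)
    refine (Nat.cast_le.2 h1).trans (h2.trans ?_)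
    rw [hq, ← pow_mul]
    push_cast
    have : (3 * (c * #S) / M : ℝ) ≤ 3 * c * K / M := by
      rw [← mul_assoc]
      gcongr
    gcongr
  have hcard : #(𝒮.biUnion bad) < #(univ : Finset (Fin N × Fin (2 * c) → Fin M)) := by
    have h1 : (#(𝒮.biUnion bad) : ℝ) < M ^ (N * (2 * c)) := by
      calc (#(𝒮.biUnion bad) : ℝ) ≤ ∑ S ∈ 𝒮, (#(bad S) : ℝ) := by exact_mod_cast card_biUnion_le
        _ ≤ ∑ S ∈ 𝒮, q ^ #S * M ^ (N * (2 * c)) := sum_le_sum hbad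
        _ = (∑ S ∈ 𝒮, q ^ #S) * M ^ (N * (2 * c)) := (sum_mul _ _ _).symm
        _ ≤ (∑ S ∈ univ.powerset.erase ∅, q ^ #S) * M ^ (N * (2 * c)) := by
          refine mul_le_mul_of_nonneg_right ?_ (by positivity)
          exact sum_le_sum_of_subset_of_nonneg (filter_subset _ _) fun _ _ _ => by positivity
        _ < 1 * M ^ (N * (2 * c)) := by
          gcongr
          exact sum_powerset_erase_empty_pow_lt_one hq0 h
        _ = _ := one_mul _
    rw [card_univ, Fintype.card_fun, Fintype.card_prod, Fintype.card_fin, Fintype.card_fin,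
      Fintype.card_fin]
    exact_mod_cast h1
  obtain ⟨f, -, hf⟩ := exists_mem_notMem_of_card_lt_card hcard
  refine ⟨hashMatrix f, card_hashMatrix_col_le f, fun x hx hxK hzero => hf ?_⟩
  refine mem_biUnion.2 ⟨(univ.filter fun j => x j ≠ 0), ?_, ?_⟩
  · refine mem_filter.2 ⟨mem_erase.2 ⟨?_, by simp⟩, hxK⟩
    intro he
    exact hx (funext fun j => by simpa using (filter_eq_empty_iff.1 he) (mem_univ j))
  -- Each coordinate of the product is the parity of a fibre of `f` over the support, so a kernel
  -- vector makes all these fibres even.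
  · have h2 := two_mul_card_image_le_of_even
      (({j | x j ≠ 0} : Finset (Fin N)) ×ˢ (univ : Finset (Fin (2 * c)))) f fun i => by
        rw [← ZMod.natCast_eq_zero_iff_even, ← hashMatrix_mulVec, hzero, Pi.zero_apply]
    rw [card_product, card_univ, Fintype.card_fin] at h2
    refine mem_filter.2 ⟨mem_univ _, ?_⟩
    nlinarith

open Finset in
/-- A matrix with at most `d` nonzero entries in every column increases the weight at most
`d`-fold. -/
theorem hammingNorm_mulVec_le {R : Type*} [Semiring R] [DecidableEq R] {m n d : ℕ}
    (A : Matrix (Fin m) (Fin n) R) (hA : ∀ j, #{i | A i j ≠ 0} ≤ d) (x : Fin n → R) :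
    hammingNorm (A.mulVec x) ≤ hammingNorm x * d := by
  calc hammingNorm (A.mulVec x)
      ≤ #(({j | x j ≠ 0} : Finset (Fin n)).biUnion fun j => {i | A i j ≠ 0}) := by
        refine card_le_card fun i hi => ?_
        by_contra hc
        simp only [mem_biUnion, mem_filter, mem_univ, true_and, not_exists, not_and,
          not_not] at hc
        refine (mem_filter.1 hi).2 (Finset.sum_eq_zero (s := univ) (f := fun j => A i j * x j)
          fun j _ => ?_)
        by_cases hj : x j = 0
        · simp [hj]
        · simp [hc j hj]
    _ ≤ hammingNorm x * d := card_biUnion_le_card_mul _ _ _ fun j _ => hA j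

open Finset in
theorem sum_entries_le_of_col {R : Type*} [Zero R] [DecidableEq R] {m n d : ℕ}
    (A : Matrix (Fin m) (Fin n) R) (hA : ∀ j, #{i | A i j ≠ 0} ≤ d) :
    (∑ i, ∑ j, if A i j ≠ 0 then 1 else 0) ≤ n * d := by
  rw [sum_comm]
  simp only [← card_filter]
  exact (sum_le_card_nsmul _ _ d fun j _ => hA j).trans (by simp)

-- A dependence among the columns in `J`, extended by zero, is a kernel vector of weight at most
-- `k`.
open Finset in
theorem linearIndependent_col_of_mulVec_ne_zero {R : Type*} [CommRing R] [DecidableEq R]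
    {m n k : ℕ} (A : Matrix (Fin m) (Fin n) R)
    (hA : ∀ x : Fin n → R, x ≠ 0 → hammingNorm x ≤ k → A.mulVec x ≠ 0)
    (J : Finset (Fin n)) (hJ : #J ≤ k) :
    LinearIndependent R (fun j : J => A.col (j : Fin n)) := by
  rw [Fintype.linearIndependent_iff]
  intro g hg
  let x : Fin n → R := fun j => if h : j ∈ J then g ⟨j, h⟩ else 0
  have hxJ : ∀ j : J, x j = g j := fun j => by simp [x]
  have hx0 : ∀ j, j ∉ J → x j = 0 := fun j hj => by simp [x, hj]
  have hxk : hammingNorm x ≤ k := by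
    refine le_trans (card_le_card fun j hj => ?_) hJ
    by_contra hc
    exact (mem_filter.1 hj).2 (hx0 j hc)
  have hzero : A.mulVec x = 0 := by
    funext i
    calc A.mulVec x i = ∑ j, A i j * x j := rfl
      _ = ∑ j ∈ J, A i j * x j :=
        (sum_subset (subset_univ J) fun j _ hj => by rw [hx0 j hj, mul_zero]).symm
      _ = ∑ j : J, g j * A i j := by
        rw [← sum_coe_sort]
        exact sum_congr rfl fun j _ => by rw [hxJ, mul_comm]
      _ = 0 := by simpa using congrFun hg i
  by_contra! hne
  obtain ⟨j, hj⟩ := hne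
  refine hA x (fun hx => hj ?_) hxk hzero
  rw [← hxJ j, hx, Pi.zero_apply]

/-! ### Growth of the uniformity parameter -/

theorem eventually_rpow_le_uniformityParam :
    ∀ᶠ n : ℕ in Filter.atTop, (n : ℝ) ^ (1 / 8 : ℝ) ≤ (uniformityParam n : ℝ) := by
  have h1 := (isLittleO_log_rpow_atTop (by norm_num : (0 : ℝ) < 1 / 8)).bound
    (by norm_num : (0 : ℝ) < 1 / 2)
  filter_upwards [tendsto_natCast_atTop_atTop.eventually h1, Filter.eventually_ge_atTop 256]
    with n hlog hn
  have hn' : (256 : ℝ) ≤ n := by exact_mod_cast hn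
  set y : ℝ := (n : ℝ) ^ (1 / 8 : ℝ) with hy
  have hy8 : y ^ 8 = n := by
    rw [hy, ← Real.rpow_natCast, ← Real.rpow_mul (by positivity)]
    norm_num
  have hy0 : 0 ≤ y := by positivity
  have hy2 : 2 ≤ y := by
    by_contra! hc
    have : y ^ 8 < 2 ^ 8 := pow_lt_pow_left₀ hc hy0 (by norm_num)
    linarith
  have hsqrt : √(n : ℝ) = y ^ 4 := by
    rw [← hy8, show y ^ 8 = (y ^ 4) ^ 2 by ring, Real.sqrt_sq (by positivity)]
  have hlogpos : 0 < Real.log n := Real.log_pos (by linarith)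
  have hL : Real.logb 2 n ≤ y := by
    rw [Real.norm_of_nonneg hlogpos.le, Real.norm_of_nonneg hy0] at hlog
    rw [Real.logb, div_le_iff₀ (Real.log_pos one_lt_two)]
    nlinarith [Real.log_two_gt_d9]
  have hL0 : 0 < Real.logb 2 n := Real.logb_pos one_lt_two (by linarith)
  -- The summand 1 pays for the floor. With `√n = y ^ 4` and `log₂ n ≤ y` it suffices that `(y + 1)
  -- * y ≤ y ^ 4`.
  have h3 : y + 1 ≤ √(n : ℝ) / Real.logb 2 n := by
    rw [le_div_iff₀ hL0, hsqrt]
    have : (y + 1) * Real.logb 2 n ≤ (y + 1) * y := by gcongr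
    nlinarith [sq_nonneg y, mul_nonneg hy0 hy0, pow_le_pow_left₀ (by norm_num) hy2 2]
  have := Nat.lt_floor_add_one (√(n : ℝ) / Real.logb 2 n)
  rw [uniformityParam]
  linarith

/-! ### The two-stage construction and the main theorem -/

/-- The syndrome matrix is the product of a sparse matrix compressing `n` coordinates to about
`n / log n` ones and a matrix with columns of weight `O(log n)`. -/
theorem exists_sparse_factors {n : ℕ} (hn : 82944 ≤ n) :
    ∃ (l m : ℕ) (A : Matrix (Fin l) (Fin n) (ZMod 2)) (Q : Matrix (Fin m) (Fin l) (ZMod 2)),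
      0 < l ∧ l ≤ n ∧ 0 < m ∧ (m : ℝ) ≤ 384 * √(n : ℝ) ∧
      (∑ i, ∑ j, if A i j ≠ 0 then 1 else 0) ≤ 8 * n ∧
      (∑ i, ∑ j, if Q i j ≠ 0 then 1 else 0) ≤ 8 * n ∧
      ∀ x : Fin n → ZMod 2, x ≠ 0 → hammingNorm x ≤ uniformityParam n →
        (Q * A).mulVec x ≠ 0 := by
  have hn' : (82944 : ℝ) ≤ n := by exact_mod_cast hn
  have hn0 : (0 : ℝ) < n := by linarith
  set s : ℝ := √(n : ℝ) with hs
  set L : ℝ := Real.logb 2 n with hL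
  set k := uniformityParam n with hk
  have hss : s * s = n := Real.mul_self_sqrt hn0.le
  have hs1 : 1 ≤ s := Real.one_le_sqrt.2 (by linarith)
  have hLn : (2 : ℝ) ^ L = n := Real.rpow_logb two_pos (by norm_num) hn0
  have hL16 : 16 ≤ L := by
    rw [hL, Real.le_logb_iff_rpow_le one_lt_two hn0]
    norm_num
    linarith
  have hL0 : 0 < L := by linarith
  have hLle : L ≤ n := by
    rw [hL, Real.logb_le_iff_le_rpow one_lt_two hn0, Real.rpow_natCast]
    exact_mod_cast Nat.lt_two_pow_self.le
  have hkle : (k : ℝ) ≤ s / L := Nat.floor_le (by positivity)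
  have hkL : (k : ℝ) * L ≤ s := (le_div_iff₀ hL0).1 hkle
  let l := ⌈(n : ℝ) / L⌉₊
  let c := ⌈L⌉₊
  let m := 192 * ⌈s⌉₊
  have hl1 : (n : ℝ) / L ≤ l := Nat.le_ceil _
  have hl2 : (l : ℝ) < n / L + 1 := Nat.ceil_lt_add_one (by positivity)
  have hc1 : L ≤ c := Nat.le_ceil _
  have hc2 : (c : ℝ) < L + 1 := Nat.ceil_lt_add_one hL0.le
  have hnL : 1 ≤ (n : ℝ) / L := (one_le_div hL0).2 hLle
  have hnL' : (n : ℝ) / L * L = n := div_mul_cancel₀ _ hL0.ne'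
  -- The factor 192 makes the base for `Q` at most `1/4`: `c * k ≤ 2 * L * k ≤ 2 * s`, so `3 * c *
  -- 8k ≤ 48 * s`.
  have hm1 : 192 * s ≤ (m : ℝ) := by
    have := Nat.le_ceil s
    simp only [m]
    push_cast
    linarith
  have hm2 : (m : ℝ) ≤ 384 * s := by
    have := Nat.ceil_lt_add_one (by linarith : 0 ≤ s)
    simp only [m]
    push_cast
    linarith
  have hlpos : 0 < l := Nat.ceil_pos.2 (by positivity)
  have hcpos : 0 < c := Nat.ceil_pos.2 hL0
  have hmpos : 0 < m := by
    have : (0 : ℝ) < m := by linarith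
    exact_mod_cast this
  have hln : (l : ℝ) ≤ n := by
    have : (n : ℝ) / L ≤ n / 16 := by gcongr
    linarith
  have hlc : l * c ≤ 4 * n := by
    have : (l : ℝ) * c ≤ (2 * (n / L)) * (2 * L) := by
      gcongr <;> linarith
    have : (l : ℝ) * c ≤ 4 * n := by nlinarith
    exact_mod_cast this
  -- The base is at most `12 / √n`, so exponent 4 beats the factor `n` and leaves `12 ^ 4 / n`. This
  -- is at most `1/4` exactly from `n = 4 * 12 ^ 4 = 82944` on.
  obtain ⟨A, hA, hAk⟩ := exists_sparse_matrix (N := n) (M := l) (c := 4) (K := k) (by omega)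
    hlpos (by norm_num) (by
      have h1 : (3 * (4 : ℕ) * k / l : ℝ) ≤ 12 / s := by
        rw [div_le_div_iff₀ (by exact_mod_cast hlpos) (by linarith)]
        push_cast
        calc (3 * 4 * k * s : ℝ) ≤ 3 * 4 * (s / L) * s := by gcongr
          _ = 12 * (n / L) := by rw [← hss]; ring
          _ ≤ 12 * l := by linarith
      calc (n : ℝ) * (3 * (4 : ℕ) * k / l : ℝ) ^ 4 ≤ (n : ℝ) * (12 / s : ℝ) ^ 4 := by gcongr
        _ = 20736 / (n : ℝ) := by rw [← hss]; field_simp; norm_num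
        _ ≤ 1 / 4 := by rw [div_le_div_iff₀ hn0 (by norm_num)]; linarith)
  -- Columns of `A` have weight at most `2 * 4`, hence the weight bound `k * 8`. The exponent `c ≥
  -- log₂ n` gives `(1/4) ^ c ≤ 1 / n²`.
  obtain ⟨Q, hQ, hQk⟩ := exists_sparse_matrix (N := l) (M := m) (c := c) (K := k * 8) hlpos
    hmpos hcpos (by
      have h1 : (3 * c * (k * 8 : ℕ) / m : ℝ) ≤ 1 / 4 := by
        rw [div_le_div_iff₀ (by exact_mod_cast hmpos) (by norm_num)]
        push_cast
        have : (c : ℝ) * k ≤ (2 * L) * k := by gcongr; linarith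
        linarith
      have h2 : (n : ℝ) ≤ 2 ^ c := by
        rw [← hLn, ← Real.rpow_natCast]
        exact Real.rpow_le_rpow_of_exponent_le one_le_two hc1
      calc (l : ℝ) * (3 * c * (k * 8 : ℕ) / m) ^ c ≤ n * (1 / 4) ^ c := by gcongr
        _ = n / (2 ^ c * 2 ^ c) := by rw [← mul_pow, div_pow, one_pow]; norm_num; rfl
        _ ≤ n / (n * n) := by gcongr
        _ = 1 / n := by field_simp
        _ ≤ 1 / 4 := by gcongr; linarith)
  refine ⟨l, m, A, Q, hlpos, by exact_mod_cast hln, hmpos, hm2, ?_, ?_, fun x hx hxk => ?_⟩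
  · exact (sum_entries_le_of_col A hA).trans (by omega)
  · exact (sum_entries_le_of_col Q hQ).trans (by nlinarith)
  · rw [← Matrix.mulVec_mulVec]
    exact hQk _ (hAk x hx hxk)
      ((hammingNorm_mulVec_le A hA x).trans (Nat.mul_le_mul_right _ hxk))

theorem sum_entries_transpose {R : Type*} [Zero R] [DecidableEq R] {m n : ℕ}
    (A : Matrix (Fin m) (Fin n) R) :
    (∑ i, ∑ j, if A.transpose i j ≠ 0 then 1 else 0) = ∑ i, ∑ j, if A i j ≠ 0 then 1 else 0 :=
  Finset.sum_comm

theorem sum_entries_le {R : Type*} [Zero R] [DecidableEq R] {m n : ℕ}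
    (A : Matrix (Fin m) (Fin n) R) : (∑ i, ∑ j, if A i j ≠ 0 then 1 else 0) ≤ m * n := by
  calc (∑ i, ∑ j, if A i j ≠ 0 then 1 else 0) ≤ ∑ _i : Fin m, ∑ _j : Fin n, 1 := by
        gcongr
        split_ifs <;> simp
    _ = m * n := by simp

theorem theorem2 :
    ∃ C : ℕ,
      -- the parameter of uniformity grows as `n ^ Ω(1)`
      (∃ ε : ℝ, 0 < ε ∧
        ∀ᶠ n : ℕ in Filter.atTop, (n : ℝ) ^ ε ≤ (uniformityParam n : ℝ)) ∧
      ∀ n : ℕ, 2 ≤ n →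
        ∃ (m : ℕ) (P : Matrix (Fin m) (Fin n) (ZMod 2)),
          (m : ℝ) ≤ (C : ℝ) * √(n : ℝ) ∧
          xorComplexity P ≤ ((C * n : ℕ) : ℕ∞) ∧
          (∀ J : Finset (Fin n), J.card = uniformityParam n →
            LinearIndependent (ZMod 2) (fun j : J => P.col (j : Fin n))) ∧
          IsKUniform (uniformityParam n)
            ((PMF.uniformOfFintype (Matrix (Fin m) (Fin m) (ZMod 2))).map
              (fun R => P.transpose * R * P)) ∧
          ∀ R : Matrix (Fin m) (Fin m) (ZMod 2),
            xorComplexity (P.transpose * R * P) ≤ ((C * n : ℕ) : ℕ∞) := by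
  refine ⟨2000000, ⟨1 / 8, by norm_num, eventually_rpow_le_uniformityParam⟩, fun n hn => ?_⟩
  have hs1 : 1 ≤ √(n : ℝ) := Real.one_le_sqrt.2 (by exact_mod_cast (by omega : 1 ≤ n))
  suffices h : ∃ (m : ℕ) (P : Matrix (Fin m) (Fin n) (ZMod 2)),
      (m : ℝ) ≤ 2000000 * √(n : ℝ) ∧ xorComplexity P ≤ ((2000000 * n : ℕ) : ℕ∞) ∧
      (∀ x : Fin n → ZMod 2, x ≠ 0 → hammingNorm x ≤ uniformityParam n → P.mulVec x ≠ 0) ∧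
      ∀ R : Matrix (Fin m) (Fin m) (ZMod 2),
        xorComplexity (P.transpose * R * P) ≤ ((2000000 * n : ℕ) : ℕ∞) by
    obtain ⟨m, P, hm, hP, hPk, hR⟩ := h
    have hind : ∀ J : Finset (Fin n), J.card = uniformityParam n →
        LinearIndependent (ZMod 2) (fun j : J => P.col (j : Fin n)) := fun J hJ =>
      linearIndependent_col_of_mulVec_ne_zero P hPk J hJ.le
    exact ⟨m, P, by exact_mod_cast hm, hP, hind, isKUniform_transpose_mul_mul P hind, hR⟩
  obtain hsmall | hlarge := lt_or_ge n 82944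
  -- For small `n` even the trivial circuit with about `n²` wires fits the constant, so `P = 1`
  -- works.
  · have hC : ∀ R : Matrix (Fin n) (Fin n) (ZMod 2),
        xorComplexity R ≤ ((2000000 * n : ℕ) : ℕ∞) := fun R =>
      (xorComplexity_le (by omega) R (sum_entries_le R)).trans (by
        exact_mod_cast (by nlinarith : n * n + 2 * n + 2 ≤ 2000000 * n))
    refine ⟨n, 1, ?_, hC 1, fun x hx _ => by rwa [Matrix.one_mulVec], fun R => hC _⟩
    have : (n : ℝ) < 82944 := by exact_mod_cast hsmall
    linarith
  · obtain ⟨l, m, A, Q, hl, hln, hm, hms, hA, hQ, hker⟩ := exists_sparse_factors hlarge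
    have hmm : m * m ≤ 147456 * n := by
      have : (m : ℝ) * m ≤ 147456 * n := by
        calc (m : ℝ) * m ≤ (384 * √(n : ℝ)) * (384 * √(n : ℝ)) := by gcongr
          _ = 147456 * (√(n : ℝ) * √(n : ℝ)) := by ring
          _ = 147456 * n := by rw [Real.mul_self_sqrt n.cast_nonneg]
      exact_mod_cast this
    -- This crude bound on the linear terms in `m` accounts for most of the constant 2000000,
    -- together with `m * m` itself.
    have hmn : m ≤ 147456 * n := (Nat.le_mul_self m).trans hmm
    have hP := xorComplexity_mul_le (xorComplexity_le hl Q hQ)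
      (xorComplexity_le (by omega) A hA)
    refine ⟨m, Q * A, by linarith, hP.trans ?_, hker, fun R => ?_⟩
    · exact_mod_cast (by omega)
    · have hQt := xorComplexity_le hm Q.transpose ((sum_entries_transpose Q).trans_le hQ)
      have hAt := xorComplexity_le hl A.transpose ((sum_entries_transpose A).trans_le hA)
      have hR := xorComplexity_le hm R (sum_entries_le R)
      -- The five factors are applied one after another; the product is never expanded into a dense
      -- matrix.
      have h := xorComplexity_mul_le hAt (xorComplexity_mul_le hQt (xorComplexity_mul_le hR hP))
      rw [show (Q * A).transpose * R * (Q * A) =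
        A.transpose * (Q.transpose * (R * (Q * A))) by
          rw [Matrix.transpose_mul]; simp only [Matrix.mul_assoc]]
      refine h.trans ?_
      exact_mod_cast (by omega)
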